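/- All Banach spaces are real. For a Banach space $Y$ let $S(Y)$ denote its unit sphere. For a set $\Gamma$ let $\ell_\infty(\Gamma,X)$ be the space of bounded functions $x:\Gamma\to X$ with the supremum norm; for $a\in \ell_1(\Gamma)$ and $x\in \ell_\infty(\Gamma,X)$ put $a(x)=\sum_{\gamma\in\Gamma}a(\gamma)x(\gamma)\in X$. For $A\subset S(\ell_1(\Gamma))$ let the index $h(X,A)\in[0,\infty]$ be the supremum of those $\delta\ge 0$ for which there exists $x\in S(\ell_\infty(\Gamma,X))$ with $\inf_{a\in A}\|a(x)\|\ge\delta$ (with $\inf\emptyset=\infty$ and $h(X,A)=0$ if $S(\ell_\infty(\Gamma,X))=\emptyset$). A class $P$ of Banach spaces is called a regular $\ell_1$-property if there exist a real number $\delta>0$, a set $\Gamma$ and a subset $A\subset S(\ell_1(\Gamma))$ such that: 1. every $a\in A$ has only finitely many non-zero coordinates; 2. if $a_0\in A$, then $A$ contains every $a\in S(\ell_1(\Gamma))$ such that $\operatorname{sign}a(\gamma)=\operatorname{sign}a_0(\gamma)$ for all $\gamma\in\Gamma$; 3. for every Banach space $X$ the following are equivalent: (a) $X\notin P$; (b)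 $h(X,A)>0$; (c) $h(X,A)\ge\delta$. **Theorem.** The class of reflexive Banach spaces is a regular $\ell_1$-property. More precisely, let $A\subset S(\ell_1)$, $\ell_1=\ell_1(\mathbb N)$, be the set of all vectors $a=(a_k)_{k\in\mathbb N}$ of norm one with only finitely many non-zero coordinates for which there is $n\in\mathbb N$ (depending on $a$) such that $a_k\ge 0$ for $k<n$ and $a_k\le 0$ for $k\ge n$. Then $A$ satisfies conditions 1 and 2, and for every Banach space $X$ the following are equivalent: (a) $X$ is non-reflexive; (b) $h(X,A)>0$; (c) $h(X,A)\ge 1/3$. -/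

import Mathlib

open scoped ENNReal

universe u v

noncomputable section

/-- The real Banach space `l_1(Γ)`. -/
abbrev L1Space (Γ : Type v) : Type v := lp (fun _ : Γ => ℝ) 1

/-- The space `l_∞(Γ, X)` of bounded functions `Γ → X` with the supremum norm. -/
abbrev LInftySpace (Γ : Type v) (X : Type u) [NormedAddCommGroup X] : Type (max u v) :=
  lp (fun _ : Γ => X) ∞

/-- The operator `l_∞(Γ, X) → X`, `x ↦ ∑ γ, a γ • x γ`, associated with `a ∈ l_1(Γ)`. -/
def l1Operator {Γ : Type v} {X : Type u} [NormedAddCommGroup X] [NormedSpace ℝ X]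
    (a : L1Space Γ) (x : LInftySpace Γ X) : X :=
  ∑' γ, a γ • x γ

/-- In a Banach space the series defining `l1Operator` is always summable. -/
theorem summable_l1Operator {Γ : Type v} {X : Type u} [NormedAddCommGroup X] [NormedSpace ℝ X]
    [CompleteSpace X] (a : L1Space Γ) (x : LInftySpace Γ X) :
    Summable (fun γ => a γ • x γ) := by
  have ha : Summable (fun γ => ‖a γ‖) := by
    have h := (lp.memℓp a).summable (by simp)
    simpa using h
  refine Summable.of_norm_bounded (ha.mul_right ‖x‖) (fun γ => ?_)
  rw [norm_smul]
  exact mul_le_mul_of_nonneg_left (lp.norm_apply_le_norm (by simp) x γ) (norm_nonneg _)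

/-- The index `h(X, A)`: the supremum of those `δ ≥ 0` for which some `x` in the unit sphere of
`l_∞(Γ, X)` satisfies `inf_{a ∈ A} ‖a(x)‖ ≥ δ`. It takes values in `[0, ∞]`, so that the supremum
and the infimum always make sense. -/
def l1Index (X : Type u) [NormedAddCommGroup X] [NormedSpace ℝ X] {Γ : Type v}
    (A : Set (L1Space Γ)) : ℝ≥0∞ :=
  sSup {δ : ℝ≥0∞ | ∃ x ∈ Metric.sphere (0 : LInftySpace Γ X) 1,
    δ ≤ ⨅ a ∈ A, ‖l1Operator a x‖ₑ}

/-- `A` consists of finitely non-zero vectors. -/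
def FinitelyNonzero {Γ : Type v} (A : Set (L1Space Γ)) : Prop :=
  ∀ a ∈ A, (Function.support (fun γ => a γ)).Finite

/-- With each vector, `A` contains all unit vectors with the same coordinatewise signs. -/
def SignSaturated {Γ : Type v} (A : Set (L1Space Γ)) : Prop :=
  ∀ a₀ ∈ A, ∀ a ∈ Metric.sphere (0 : L1Space Γ) 1,
    (∀ γ, SignType.sign (a₀ γ) = SignType.sign (a γ)) → a ∈ A

/-- Regular `l_1`-properties of real Banach spaces. -/
def IsRegularL1Property
    (P : ∀ (X : Type u) [NormedAddCommGroup X] [NormedSpace ℝ X] [CompleteSpace X], Prop) : Prop :=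
  ∃ δ : ℝ, 0 < δ ∧ ∃ (Γ : Type v) (A : Set (L1Space Γ)),
    A ⊆ Metric.sphere (0 : L1Space Γ) 1 ∧
    FinitelyNonzero A ∧
    SignSaturated A ∧
    ∀ (X : Type u) [NormedAddCommGroup X] [NormedSpace ℝ X] [CompleteSpace X],
      List.TFAE [¬ P X, 0 < l1Index X A, ENNReal.ofReal δ ≤ l1Index X A]

/-- Reflexivity: the canonical embedding into the second dual is onto. -/
def IsReflexiveSpace (X : Type u) [NormedAddCommGroup X] [NormedSpace ℝ X] : Prop :=
  Function.Surjective (NormedSpace.inclusionInDoubleDual ℝ X)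

/-- The finitely non-zero unit vectors of `l_1` whose coordinates are nonnegative before some
index `n` and nonpositive from `n` on. -/
def singleSignChangeSet : Set (L1Space ℕ) :=
  {a | a ∈ Metric.sphere (0 : L1Space ℕ) 1 ∧ (Function.support (fun k => a k)).Finite ∧
    ∃ n : ℕ, (∀ k, n ≤ k → a k ≤ 0) ∧ (∀ k, k < n → 0 ≤ a k)}

end

/-! In a non-reflexive space, James' construction (`exists_james_sequences`) gives points `x k` and
functionals `f n` in the unit balls with `f n (x k)` near `0` for `k < n` and near a fixed `θ`,
itself close to `1`, for `n ≤ k`. The functionals `(f 0 - 2 f n) / 3` have norm at most one and are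
about `θ / 3` before `n` and `-θ / 3` from `n` on, so they keep every `‖a(x)‖` above nearly `1 / 3`.
Conversely, in a reflexive space the closed convex hulls of all tails of a bounded sequence share a
point `z` (`IsReflexiveSpace.exists_mem_closure_convexHull`). Near `z` lie a convex combination of
finitely many terms and one of later terms; half their difference is `a(x)` for some `a` in the set,
so the infimum is zero. -/

set_option maxSynthPendingDepth 3

/-! ### Goldstine's theorem and James' sequences -/

section Duality

variable {Y : Type*} [NormedAddCommGroup Y] [NormedSpace ℝ Y]

/-- Goldstine's theorem for finitely many functionals. -/
theorem exists_norm_le_one_forall_abs_sub_lt (T : Finset (StrongDual ℝ Y))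
    (G : StrongDual ℝ (StrongDual ℝ Y)) (hG : ‖G‖ ≤ 1) {ε : ℝ} (hε : 0 < ε) :
    ∃ y : Y, ‖y‖ ≤ 1 ∧ ∀ f ∈ T, |f y - G f| < ε := by
  classical
  let L : Y →L[ℝ] (T → ℝ) := ContinuousLinearMap.pi fun f => f.1
  let p : T → ℝ := fun f => G f.1
  have hp : p ∈ closure (L '' Metric.closedBall 0 1) := by
    by_contra hp
    obtain ⟨φ, c, hφ, hc⟩ := geometric_hahn_banach_closed_point
      (((convex_closedBall (0 : Y) 1).linear_image L.toLinearMap).closure) isClosed_closure hp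
    -- `g` is a linear combination of the functionals in `T`, so `G g = φ p`. Separation then gives
    -- `‖g‖ ≤ c < G g`, against `‖G‖ ≤ 1`.
    let g : StrongDual ℝ Y := φ.comp L
    have hg : g = ∑ f : T, φ (fun j => if f = j then 1 else 0) • f.1 := by
      ext y
      have := LinearMap.pi_apply_eq_sum_univ φ.toLinearMap (L y)
      simpa [g, L, mul_comm, sum_apply] using this
    have hGg : G g = φ p := by
      have := LinearMap.pi_apply_eq_sum_univ φ.toLinearMap p
      rw [hg, map_sum]
      simpa [p, mul_comm] using this.symm
    have hlt : ∀ y, ‖y‖ ≤ 1 → g y < c := fun y hy =>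
      hφ (L y) (subset_closure ⟨y, by simpa using hy, rfl⟩)
    have hc0 : 0 ≤ c := by simpa using (hlt 0 (by simp)).le
    have hgc : ‖g‖ ≤ c := by
      refine g.opNorm_le_of_unit_norm hc0 fun y hy => ?_
      rw [Real.norm_eq_abs, abs_le]
      have h1 := hlt y hy.le
      have h2 := hlt (-y) (by simp [hy])
      rw [map_neg] at h2
      constructor <;> linarith
    have h3 : G g ≤ ‖g‖ := by
      calc G g ≤ ‖G g‖ := Real.le_norm_self _
        _ ≤ ‖G‖ * ‖g‖ := G.le_opNorm g
        _ ≤ 1 * ‖g‖ := by gcongr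
        _ = ‖g‖ := one_mul _
    linarith
  obtain ⟨_, ⟨y, hy, rfl⟩, hd⟩ := Metric.mem_closure_iff.1 hp ε hε
  refine ⟨y, by simpa using hy, fun f hf => ?_⟩
  have := (dist_le_pi_dist p (L y) ⟨f, hf⟩).trans_lt hd
  rwa [Real.dist_eq, abs_sub_comm] at this

variable [CompleteSpace Y]

/-- In a non-reflexive Banach space, some functional of norm at most one on the dual is almost at
distance one from the space, and this is witnessed by a functional on the bidual. -/
theorem exists_bidual_and_annihilator (h : ¬ IsReflexiveSpace Y) {r : ℝ} (hr : r < 1) :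
    ∃ (F : StrongDual ℝ (StrongDual ℝ Y)) (Φ : StrongDual ℝ (StrongDual ℝ (StrongDual ℝ Y))),
      ‖F‖ ≤ 1 ∧ ‖Φ‖ ≤ 1 ∧ r ≤ Φ F ∧
        ∀ y : Y, Φ (NormedSpace.inclusionInDoubleDual ℝ Y y) = 0 := by
  let J := NormedSpace.inclusionInDoubleDualLi ℝ (E := Y)
  let S : Submodule ℝ (StrongDual ℝ (StrongDual ℝ Y)) := LinearMap.range J.toLinearMap
  have hS : IsClosed (S : Set (StrongDual ℝ (StrongDual ℝ Y))) := by
    have : IsClosed (Set.range J) := J.isometry.isClosedEmbedding.isClosed_range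
    exact this
  have hne : ∃ F, F ∉ S := by
    by_contra! hall
    exact h fun F => hall F
  obtain ⟨F₀, hF₀, hdist⟩ := riesz_lemma hS hne hr
  have hF₀' : 0 < ‖F₀‖ := norm_pos_iff.2 fun h0 => hF₀ (h0 ▸ S.zero_mem)
  obtain ⟨g, hg, hgF⟩ := exists_dual_vector'' ℝ (S.mkQ F₀)
  have hle : ∀ F, ‖S.mkQ F‖ ≤ ‖F‖ := fun F => Submodule.Quotient.norm_mk_le S F
  -- A norming functional for the class of `F₀` modulo the canonical image of `Y`, pulled back: it
  -- kills `Y`, and its value at `F₀` is the distance from `F₀` to `Y`.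
  let Φ : StrongDual ℝ (StrongDual ℝ (StrongDual ℝ Y)) :=
    LinearMap.mkContinuous (g.toLinearMap ∘ₗ S.mkQ) 1 fun F => by
      calc ‖g (S.mkQ F)‖ ≤ ‖g‖ * ‖S.mkQ F‖ := g.le_opNorm _
        _ ≤ 1 * ‖F‖ := by gcongr; exact hle F
  have hlow : r * ‖F₀‖ ≤ ‖S.mkQ F₀‖ := by
    have : ‖S.mkQ F₀‖ = Metric.infDist F₀ (S : Set (StrongDual ℝ (StrongDual ℝ Y))) :=
      QuotientAddGroup.norm_mk (S := S.toAddSubgroup) F₀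
    rw [this]
    refine (Metric.le_infDist ⟨0, S.zero_mem⟩).2 fun y hy => ?_
    rw [dist_eq_norm]
    exact hdist y hy
  refine ⟨‖F₀‖⁻¹ • F₀, Φ, ?_, LinearMap.mkContinuous_norm_le _ zero_le_one _, ?_, fun y => ?_⟩
  · rw [norm_smul, norm_inv, norm_norm, inv_mul_cancel₀ hF₀'.ne']
  · have : Φ F₀ = ‖S.mkQ F₀‖ := hgF
    rw [map_smul, this, smul_eq_mul, inv_mul_eq_div, le_div_iff₀ hF₀']
    exact hlow
  · have : S.mkQ (NormedSpace.inclusionInDoubleDual ℝ Y y) = 0 :=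
      (Submodule.Quotient.mk_eq_zero S).2 ⟨y, rfl⟩
    change g (S.mkQ (NormedSpace.inclusionInDoubleDual ℝ Y y)) = 0
    rw [this, map_zero]

/-- James' biorthogonal-type sequences in a non-reflexive space. -/
theorem exists_james_sequences (h : ¬ IsReflexiveSpace Y) {r ε : ℝ} (hr : r < 1) (hε : 0 < ε) :
    ∃ (θ : ℝ) (x : ℕ → Y) (f : ℕ → StrongDual ℝ Y), r ≤ θ ∧
      (∀ n, ‖x n‖ ≤ 1) ∧ (∀ n, ‖f n‖ ≤ 1) ∧
      (∀ n k, k < n → |f n (x k)| < ε) ∧ ∀ n k, n ≤ k → |f n (x k) - θ| < ε := by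
  classical
  obtain ⟨F, Φ, hF, hΦ, hθ, hΦ0⟩ := exists_bidual_and_annihilator h hr
  have hε2 : 0 < ε / 2 := half_pos hε
  obtain ⟨s, hs, hs'⟩ := exists_seq_of_forall_finset_exists
    (fun q : Y × StrongDual ℝ Y => ‖q.1‖ ≤ 1 ∧ ‖q.2‖ ≤ 1 ∧ |F q.2 - Φ F| < ε / 2 ∧
      |q.2 q.1 - F q.2| < ε / 2)
    (fun q q' => |q'.2 q.1| < ε ∧ |q.2 q'.1 - F q.2| < ε / 2) (by
      intro s _
      -- Goldstine one level up: `g` imitates `Φ` on `F` and on the earlier points, where `Φ`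
      -- vanishes. Then `y` imitates `F` on the earlier functionals and on `g` itself, which covers
      -- the case `k = n`.
      obtain ⟨g, hg, hg'⟩ := exists_norm_le_one_forall_abs_sub_lt
        (insert F (s.image fun q => NormedSpace.inclusionInDoubleDual ℝ Y q.1)) Φ hΦ hε2
      obtain ⟨y, hy, hy'⟩ := exists_norm_le_one_forall_abs_sub_lt
        (insert g (s.image Prod.snd)) F hF hε2
      refine ⟨(y, g), ⟨hy, hg, hg' F (Finset.mem_insert_self _ _),
        hy' g (Finset.mem_insert_self _ _)⟩, fun q hq => ⟨?_, ?_⟩⟩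
      · have := hg' (NormedSpace.inclusionInDoubleDual ℝ Y q.1)
          (Finset.mem_insert_of_mem (Finset.mem_image_of_mem _ hq))
        rw [hΦ0, sub_zero, NormedSpace.dual_def] at this
        exact this.trans (half_lt_self hε)
      · exact hy' q.2 (Finset.mem_insert_of_mem (Finset.mem_image_of_mem _ hq)))
  refine ⟨Φ F, fun n => (s n).1, fun n => (s n).2, hθ, fun n => (hs n).1, fun n => (hs n).2.1,
    fun n k hkn => (hs' k n hkn).1, fun n k hnk => ?_⟩
  have h1 := (hs n).2.2.1
  have h2 : |(s n).2 (s k).1 - F (s n).2| < ε / 2 := by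
    rcases hnk.eq_or_lt with rfl | hlt
    · exact (hs n).2.2.2
    · exact (hs' n k hlt).2
  have := abs_sub_le ((s n).2 (s k).1) (F (s n).2) (Φ F)
  dsimp only
  linarith

end Duality

/-! ### The index of the sign-change set -/

section SignChange

/-- The analogue of `singleSignChangeSet` for an index set enumerated by `e`. -/
def enumSignChangeSet {Γ : Type v} (e : Γ ≃ ℕ) : Set (L1Space Γ) :=
  {a | a ∈ Metric.sphere (0 : L1Space Γ) 1 ∧ (Function.support (fun k => a k)).Finite ∧
    ∃ n : ℕ, (∀ k, n ≤ e k → a k ≤ 0) ∧ (∀ k, e k < n → 0 ≤ a k)}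

variable {Γ : Type v} (e : Γ ≃ ℕ)

theorem finitelyNonzero_enumSignChangeSet : FinitelyNonzero (enumSignChangeSet e) :=
  fun _ ha => ha.2.1

theorem signSaturated_enumSignChangeSet : SignSaturated (enumSignChangeSet e) := by
  rintro a₀ ⟨-, hfin, n, hneg, hpos⟩ a ha hsign
  refine ⟨ha, hfin.subset fun γ hγ h0 => hγ ?_, n, fun γ hγ => ?_, fun γ hγ => ?_⟩
  · have := hsign γ
    rw [show a₀ γ = 0 from h0, sign_zero] at this
    exact sign_eq_zero_iff.1 this.symm
  · have := hneg γ hγ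
    rw [← not_lt, ← sign_eq_one_iff, hsign γ, sign_eq_one_iff, not_lt] at this
    exact this
  · have := hpos γ hγ
    rw [← not_lt, ← sign_eq_neg_one_iff, hsign γ, sign_eq_neg_one_iff, not_lt] at this
    exact this

theorem l1Space_hasSum_norm (a : L1Space Γ) : HasSum (fun γ => |a γ|) ‖a‖ := by
  have := lp.hasSum_norm (p := 1) (by simp) a
  simpa using this

variable {X : Type u} [NormedAddCommGroup X] [NormedSpace ℝ X]

/-- If `a` changes sign at `n`, the signs of `g n (x γ)` match those of `a γ`, so each term of `g n
(a(x))` is at least `c * |a γ|`, and these bounds sum to `c`. -/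
theorem le_norm_l1Operator {e : Γ ≃ ℕ} {x : LInftySpace Γ X} {g : ℕ → StrongDual ℝ X} {c : ℝ}
    (hg : ∀ n, ‖g n‖ ≤ 1) (hpos : ∀ n γ, e γ < n → c ≤ g n (x γ))
    (hneg : ∀ n γ, n ≤ e γ → g n (x γ) ≤ -c) {a : L1Space Γ} (ha : a ∈ enumSignChangeSet e) :
    c ≤ ‖l1Operator a x‖ := by
  obtain ⟨hnorm, hfin, n, hn1, hn2⟩ := ha
  have hsum : HasSum (fun γ => a γ • x γ) (l1Operator a x) := by
    refine (summable_of_hasFiniteSupport (hfin.subset fun γ hγ h0 => hγ ?_)).hasSum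
    simp only at h0
    simp [h0]
  have h1 := hsum.mapL (g n)
  have h2 := (l1Space_hasSum_norm a).mul_right c
  rw [mem_sphere_zero_iff_norm.1 hnorm, one_mul] at h2
  have hle : c ≤ g n (l1Operator a x) := by
    refine hasSum_le (fun γ => ?_) h2 h1
    rw [map_smul, smul_eq_mul]
    rcases lt_or_ge (e γ) n with hlt | hge
    · rw [abs_of_nonneg (hn2 γ hlt)]
      exact mul_le_mul_of_nonneg_left (hpos n γ hlt) (hn2 γ hlt)
    · rw [abs_of_nonpos (hn1 γ hge)]
      have := mul_le_mul_of_nonpos_left (hneg n γ hge) (hn1 γ hge)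
      linarith
  calc c ≤ g n (l1Operator a x) := hle
    _ ≤ ‖g n (l1Operator a x)‖ := Real.le_norm_self _
    _ ≤ ‖g n‖ * ‖l1Operator a x‖ := (g n).le_opNorm _
    _ ≤ 1 * ‖l1Operator a x‖ := by gcongr; exact hg n
    _ = _ := one_mul _

theorem le_l1Index_of_functionals (e : Γ ≃ ℕ) {x : ℕ → X} {g : ℕ → StrongDual ℝ X} {c : ℝ}
    (hc : 0 < c) (hx : ∀ n, ‖x n‖ ≤ 1)
    (hg : ∀ n, ‖g n‖ ≤ 1) (hpos : ∀ n k, k < n → c ≤ g n (x k))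
    (hneg : ∀ n k, n ≤ k → g n (x k) ≤ -c) :
    ENNReal.ofReal c ≤ l1Index X (enumSignChangeSet e) := by
  let y : LInftySpace Γ X := ⟨fun γ => x (e γ), memℓp_infty ⟨1, by
    rintro _ ⟨γ, rfl⟩
    exact hx _⟩⟩
  have hy1 : ‖y‖ ≤ 1 := lp.norm_le_of_forall_le zero_le_one fun γ => hx _
  have hy0 : 0 < ‖y‖ := by
    refine norm_pos_iff.2 fun h0 => ?_
    have h1 : x (e (e.symm 0)) = 0 := congrArg (fun z : LInftySpace Γ X => z (e.symm 0)) h0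
    have h2 := hneg 0 0 le_rfl
    rw [e.apply_symm_apply] at h1
    rw [h1, map_zero] at h2
    linarith
  -- Normalizing `y` multiplies by a factor at least one, so the bounds `c` and `-c` survive.
  have hinv : 1 ≤ ‖y‖⁻¹ := (one_le_inv₀ hy0).2 hy1
  refine le_sSup ⟨‖y‖⁻¹ • y, ?_, le_iInf₂ fun a ha => ?_⟩
  · rw [mem_sphere_zero_iff_norm, norm_smul, norm_inv, norm_norm, inv_mul_cancel₀ hy0.ne']
  · rw [← ofReal_norm]
    refine ENNReal.ofReal_le_ofReal (le_norm_l1Operator hg (fun n γ h => ?_) (fun n γ h => ?_) ha)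
    · have : (‖y‖⁻¹ • y) γ = ‖y‖⁻¹ • x (e γ) := rfl
      rw [this, map_smul, smul_eq_mul]
      have := hpos n (e γ) h
      nlinarith
    · have : (‖y‖⁻¹ • y) γ = ‖y‖⁻¹ • x (e γ) := rfl
      rw [this, map_smul, smul_eq_mul]
      have := hneg n (e γ) h
      nlinarith

theorem ofReal_one_third : ENNReal.ofReal (1 / 3) = 1 / 3 := by
  rw [ENNReal.ofReal_div_of_pos (by norm_num)]
  simp

theorem third_le_l1Index [CompleteSpace X] (e : Γ ≃ ℕ) (h : ¬ IsReflexiveSpace X) :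
    1 / 3 ≤ l1Index X (enumSignChangeSet e) := by
  have key : ∀ c : ℝ, 0 < c → c < 1 / 3 →
      ENNReal.ofReal c ≤ l1Index X (enumSignChangeSet e) := by
    intro c hc hc3
    have hε : 0 < 1 / 3 - c := by linarith
    obtain ⟨θ, x, f, hθ, hx, hf, hlt, hge⟩ :=
      -- Chosen so that `(r - 3 * ε) / 3 = c`: the errors in `f 0` and `2 f n` total `3 * ε`.
      exists_james_sequences h (r := 1 - 3 / 2 * (1 / 3 - c)) (ε := (1 / 3 - c) / 2)
        (by linarith) (by linarith)
    refine le_l1Index_of_functionals e (x := x)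
      (g := fun n => (3 : ℝ)⁻¹ • (f 0 - (2 : ℝ) • f n)) hc hx (fun n => ?_) (fun n k hk => ?_)
      (fun n k hk => ?_)
    · have h1 : ‖f 0 - (2 : ℝ) • f n‖ ≤ 3 := by
        refine (norm_sub_le _ _).trans ?_
        rw [norm_smul, Real.norm_ofNat]
        linarith [hf 0, hf n]
      rw [norm_smul, norm_inv, Real.norm_ofNat]
      linarith
    · have h1 := abs_lt.1 (hge 0 k (zero_le))
      have h2 := abs_lt.1 (hlt n k hk)
      simp only [FunLike.coe_smul, FunLike.coe_sub, Pi.smul_apply, Pi.sub_apply, smul_eq_mul]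
      linarith
    · have h1 := abs_lt.1 (hge 0 k (zero_le))
      have h2 := abs_lt.1 (hge n k hk)
      simp only [FunLike.coe_smul, FunLike.coe_sub, Pi.smul_apply, Pi.sub_apply, smul_eq_mul]
      linarith
  rw [← ofReal_one_third]
  refine le_of_forall_lt fun b hb => ?_
  obtain ⟨c, hbc, hc⟩ := exists_between hb
  have hctop : c ≠ ∞ := (hc.trans_le le_top).ne
  have hc0 : 0 < c := (zero_le).trans_lt hbc
  refine hbc.trans_le ?_
  rw [← ENNReal.ofReal_toReal hctop]
  refine key _ (ENNReal.toReal_pos hc0.ne' hctop) ?_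
  rw [← ENNReal.ofReal_toReal hctop] at hc
  exact (ENNReal.ofReal_lt_ofReal_iff (by norm_num)).1 hc

/-- Points of the convex hull of a family are finite convex combinations. -/
theorem exists_finsupp_of_mem_convexHull {ι : Type*} {x : ι → X} {S : Set ι} {z : X}
    (hz : z ∈ convexHull ℝ (x '' S)) :
    ∃ w : ι →₀ ℝ, (∀ i, 0 ≤ w i) ∧ (∀ i, i ∉ S → w i = 0) ∧ HasSum (fun i => w i) 1 ∧
      HasSum (fun i => w i • x i) z := by
  have himage : x '' S = Finsupp.linearCombination ℝ x '' ((fun i => Finsupp.single i 1) '' S) := by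
    rw [Set.image_image]
    simp
  rw [himage, ← LinearMap.image_convexHull] at hz
  obtain ⟨w, hw, rfl⟩ := hz
  have hsum : HasSum (fun i => w i • x i) (Finsupp.linearCombination ℝ x w) :=
    hasSum_sum_of_ne_finset_zero fun i hi => by rw [Finsupp.notMem_support_iff.1 hi, zero_smul]
  have hone : HasSum (fun i => w i • (1 : ℝ)) (Finsupp.linearCombination ℝ (fun _ => (1 : ℝ)) w) :=
    hasSum_sum_of_ne_finset_zero fun i hi => by rw [Finsupp.notMem_support_iff.1 hi, zero_smul]
  -- The simplex of weights supported on `S` is convex and contains the unit vectors indexed by `S`.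
  have hw' : w ∈ {w : ι →₀ ℝ | (∀ i, 0 ≤ w i) ∧ (∀ i, i ∉ S → w i = 0) ∧
      Finsupp.linearCombination ℝ (fun _ => (1 : ℝ)) w = 1} := by
    refine convexHull_min ?_ ?_ hw
    · rintro _ ⟨j, hj, rfl⟩
      refine ⟨fun i => ?_, fun i hi => ?_, by simp⟩
      · exact (Finsupp.single_nonneg.2 zero_le_one : (0 : ι →₀ ℝ) ≤ Finsupp.single j 1) i
      · exact Finsupp.single_eq_of_ne fun hij => hi (hij ▸ hj)
    · rintro w₁ ⟨h1, h2, h3⟩ w₂ ⟨h1', h2', h3'⟩ s t hs ht hst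
      refine ⟨fun i => ?_, fun i hi => ?_, ?_⟩
      · exact add_nonneg (mul_nonneg hs (h1 i)) (mul_nonneg ht (h1' i))
      · simp [h2 i hi, h2' i hi]
      · simp only [map_add, map_smul, h3, h3', smul_eq_mul, mul_one, hst]
  rw [hw'.2.2] at hone
  exact ⟨w, hw'.1, hw'.2.1, by simpa using hone, hsum⟩

/-- Convex combinations of the terms before and from an index on give elements of the set. -/
theorem exists_mem_enumSignChangeSet (e : Γ ≃ ℕ) (x : LInftySpace Γ X) (n : ℕ) {y z : X}
    (hy : y ∈ convexHull ℝ ((fun γ => x γ) '' {γ | e γ < n}))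
    (hz : z ∈ convexHull ℝ ((fun γ => x γ) '' {γ | n ≤ e γ})) :
    ∃ a ∈ enumSignChangeSet e, l1Operator a x = (2 : ℝ)⁻¹ • (y - z) := by
  obtain ⟨w₁, hw₁, hs₁, h1, hy⟩ := exists_finsupp_of_mem_convexHull hy
  obtain ⟨w₂, hw₂, hs₂, h2, hz⟩ := exists_finsupp_of_mem_convexHull hz
  have hs₁' : ∀ γ, n ≤ e γ → w₁ γ = 0 := fun γ h => hs₁ γ (not_lt.2 h)
  have hs₂' : ∀ γ, e γ < n → w₂ γ = 0 := fun γ h => hs₂ γ (not_le.2 h)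
  -- The supports are disjoint, so the `ℓ₁` norm is `(1 + 1) / 2`.
  let w : Γ →₀ ℝ := (2 : ℝ)⁻¹ • (w₁ - w₂)
  have hw : ∀ γ, w γ = 2⁻¹ * (w₁ γ - w₂ γ) := fun γ => rfl
  have habs : ∀ γ, |w γ| = 2⁻¹ * (w₁ γ + w₂ γ) := by
    intro γ
    rw [hw]
    rcases lt_or_ge (e γ) n with h | h
    · rw [hs₂' γ h, abs_of_nonneg (by simpa using hw₁ γ)]
      ring
    · rw [hs₁' γ h, abs_of_nonpos (by simpa using hw₂ γ)]
      ring
  have hmem : Memℓp (fun γ => w γ) (1 : ℝ≥0∞) := by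
    refine (memℓp_zero ?_).of_exponent_ge (zero_le)
    exact w.hasFiniteSupport
  let a : L1Space Γ := ⟨fun γ => w γ, hmem⟩
  have ha : ∀ γ, a γ = w γ := fun γ => rfl
  refine ⟨a, ⟨?_, w.hasFiniteSupport, n, fun γ h => ?_, fun γ h => ?_⟩, ?_⟩
  · rw [mem_sphere_zero_iff_norm]
    refine (l1Space_hasSum_norm a).unique ?_
    have := (h1.add h2).mul_left (2 : ℝ)⁻¹
    norm_num at this
    simpa only [ha, habs, one_div] using this
  · rw [ha, hw, hs₁' γ h]
    linarith [hw₂ γ]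
  · rw [ha, hw, hs₂' γ h]
    linarith [hw₁ γ]
  · have := (hy.sub hz).const_smul (2 : ℝ)⁻¹
    refine HasSum.tsum_eq ?_
    simpa only [ha, hw, ← sub_smul, smul_smul] using this

/-- In a reflexive space, tails of a bounded sequence have a common point in their closed convex
hulls. -/
theorem IsReflexiveSpace.exists_mem_closure_convexHull (h : IsReflexiveSpace X) (x : ℕ → X)
    {M : ℝ} (hx : ∀ n, ‖x n‖ ≤ M) :
    ∃ z, ∀ n, z ∈ closure (convexHull ℝ (x '' {k | n ≤ k})) := by
  let J : ℕ → WeakDual ℝ (StrongDual ℝ X) := fun n =>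
    StrongDual.toWeakDual (NormedSpace.inclusionInDoubleDual ℝ X (x n))
  have hK := WeakDual.isCompact_closedBall (0 : StrongDual ℝ (StrongDual ℝ X)) M
  -- Banach–Alaoglu gives a weak-star limit in the bidual along `U`; reflexivity makes it a point
  -- `z`. Every tail belongs to `U`, so no functional separates `z` from a tail's hull.
  let U : Ultrafilter ℕ := Filter.hyperfilter ℕ
  obtain ⟨G, -, hG⟩ := hK.ultrafilter_le_nhds (U.map J) (by
    refine Filter.le_principal_iff.2 (Filter.mem_map.2 (Filter.univ_mem' fun n => ?_))
    refine mem_closedBall_zero_iff.2 ?_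
    exact (NormedSpace.double_dual_bound ℝ X (x n)).trans (hx n))
  obtain ⟨z, hz⟩ := h (WeakDual.toStrongDual G)
  refine ⟨z, fun n => ?_⟩
  by_contra hzn
  obtain ⟨f, c, hfz, hf⟩ := geometric_hahn_banach_point_closed
    (convex_convexHull ℝ (x '' {k | n ≤ k})).closure isClosed_closure hzn
  have hlim : Filter.Tendsto (fun k => f (x k)) U (nhds (f z)) := by
    have h1 : Filter.Tendsto J U (nhds G) := hG
    have h2 := ((WeakDual.eval_continuous f).tendsto G).comp h1
    have h3 : G f = f z := (DFunLike.congr_fun hz f).symm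
    rw [h3] at h2
    exact h2
  have hev : ∀ᶠ k in (U : Filter ℕ), c ≤ f (x k) := by
    refine Filter.Eventually.filter_mono (Nat.hyperfilter_le_atTop) ?_
    filter_upwards [Filter.eventually_ge_atTop n] with k hk
    exact (hf _ (subset_closure (subset_convexHull ℝ _ ⟨k, hk, rfl⟩))).le
  exact absurd (ge_of_tendsto hlim hev) (not_le.2 hfz)

theorem not_isReflexiveSpace_of_l1Index_pos (e : Γ ≃ ℕ)
    (h : 0 < l1Index X (enumSignChangeSet e)) : ¬ IsReflexiveSpace X := by
  intro hrefl
  obtain ⟨δ, ⟨x, -, hδ⟩, hδ0⟩ := lt_sSup_iff.1 h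
  obtain ⟨c, hc0, hcδ⟩ := ENNReal.lt_iff_exists_nnreal_btwn.1 hδ0
  have hc : (0 : ℝ) < c := by exact_mod_cast hc0
  have hA : ∀ a ∈ enumSignChangeSet e, (c : ℝ) ≤ ‖l1Operator a x‖ := fun a ha => by
    have : (c : ℝ≥0∞) ≤ ‖l1Operator a x‖ₑ := hcδ.le.trans (hδ.trans (iInf₂_le a ha))
    rw [← ofReal_norm, ← ENNReal.ofReal_coe_nnreal] at this
    exact (ENNReal.ofReal_le_ofReal_iff (norm_nonneg _)).1 this
  obtain ⟨z, hz⟩ := hrefl.exists_mem_closure_convexHull (fun k => x (e.symm k))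
    (fun k => lp.norm_apply_le_norm (by simp) x _)
  have himage : ∀ n, (fun k => x (e.symm k)) '' {k | n ≤ k} =
      (fun γ => x γ) '' {γ | n ≤ e γ} := fun n => by
    ext y
    constructor
    · rintro ⟨k, hk, rfl⟩
      exact ⟨e.symm k, by simpa using hk, rfl⟩
    · rintro ⟨γ, hγ, rfl⟩
      exact ⟨e γ, hγ, by simp⟩
  simp only [himage] at hz
  obtain ⟨y, hy, hzy⟩ := Metric.mem_closure_iff.1 (hz 0) c hc
  -- A convex combination uses finitely many terms, which fixes the index `n` of the sign change
  -- before `v` is taken from the tail.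
  have hy' : y ∈ ⋃ n, convexHull ℝ ((fun γ => x γ) '' {γ | e γ < n}) := by
    refine convexHull_min ?_ ?_ hy
    · rintro _ ⟨γ, -, rfl⟩
      exact Set.mem_iUnion.2 ⟨e γ + 1, subset_convexHull ℝ _ ⟨γ, Nat.lt_succ_self _, rfl⟩⟩
    · refine Directed.convex_iUnion (Monotone.directed_le fun m n hmn => ?_)
        fun n => convex_convexHull ℝ _
      exact convexHull_mono (Set.image_mono fun γ hγ => lt_of_lt_of_le hγ hmn)
  obtain ⟨n, hn⟩ := Set.mem_iUnion.1 hy'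
  obtain ⟨v, hv, hzv⟩ := Metric.mem_closure_iff.1 (hz n) c hc
  obtain ⟨a, ha, hax⟩ := exists_mem_enumSignChangeSet e x n hn hv
  have hle := hA a ha
  rw [hax, norm_smul, norm_inv, Real.norm_ofNat, ← dist_eq_norm] at hle
  linarith [dist_triangle_left y v z]

theorem tfae_enumSignChangeSet [CompleteSpace X] (e : Γ ≃ ℕ) :
    List.TFAE [¬ IsReflexiveSpace X, 0 < l1Index X (enumSignChangeSet e),
      1 / 3 ≤ l1Index X (enumSignChangeSet e)] := by
  tfae_have 1 → 3 := third_le_l1Index e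
  tfae_have 3 → 2 := fun h => lt_of_lt_of_le (by simp) h
  tfae_have 2 → 1 := not_isReflexiveSpace_of_l1Index_pos e
  tfae_finish

end SignChange

theorem mainTheorem5 :
    IsRegularL1Property.{u, v} (fun X _ _ _ => IsReflexiveSpace X) ∧
    FinitelyNonzero singleSignChangeSet ∧
    SignSaturated singleSignChangeSet ∧
    ∀ (X : Type u) [NormedAddCommGroup X] [NormedSpace ℝ X] [CompleteSpace X],
      List.TFAE [¬ IsReflexiveSpace X,
        0 < l1Index X singleSignChangeSet,
        1 / 3 ≤ l1Index X singleSignChangeSet] := by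
  -- The index set must live in universe `v`, hence the lifted copy of `ℕ`; for `Equiv.refl ℕ` the
  -- enumerated set is `singleSignChangeSet` by definition.
  refine ⟨⟨1 / 3, by norm_num, ULift.{v} ℕ, enumSignChangeSet Equiv.ulift, fun a ha => ha.1,
    finitelyNonzero_enumSignChangeSet _, signSaturated_enumSignChangeSet _, fun X _ _ _ => ?_⟩,
    finitelyNonzero_enumSignChangeSet (Equiv.refl ℕ),
    signSaturated_enumSignChangeSet (Equiv.refl ℕ),
    fun X _ _ _ => tfae_enumSignChangeSet (Equiv.refl ℕ)⟩
  rw [ofReal_one_third]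
  exact tfae_enumSignChangeSet Equiv.ulift
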